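/- **Setting.** Every finite-dimensional system carries a fixed orthonormal basis. A state (density matrix) is *incoherent* if it is diagonal in that basis and *coherent* otherwise; composite systems carry the product basis. An *incoherent operation* is a completely positive trace-preserving map which either (reading 1) maps every incoherent state to an incoherent state, or (reading 2) has a Kraus representation $\Phi(X)=\sum_k K_kXK_k^\dagger$, $\sum_k K_k^\dagger K_k=\mathbb 1$, in which every $K_k\sigma K_k^\dagger$ is diagonal for every incoherent $\sigma$. The theorem below holds for each of the two readings. Let $h^{(1)},h^{(2)},\dots$ be a fixed sequence (not depending on $N$) of Hermitian operators, $h^{(i)}$ acting on a particle of finite dimension $d_i$ whose fixed basis consists of eigenvectors of $h^{(i)}$. Assume that the spectral spreads $\phi_i=\lambda_{\max}(h^{(i)})-\lambda_{\min}(h^{(i)})$ satisfy $0<m\le\phi_i\le M<\infty$ for all $i$, with $m,M$ independent of $i$. Let $H_N=\sum_{i=1}^N h^{(i)}$, each $h^{(i)}$ acting on the $i$-th of $N$ particles. For a state $\rho$ with eigenvalues $\lambda_i$ and orthonormal eigenvectors $|i\rangle$, the quantum Fisher information is $$\mathcal F(\rho,H)=2\sum_{i,j:\ \lambda_i+\lambda_j>0}\frac{(\lambda_i-\lambda_j)^2}{\lambda_i+\lambda_j}\,|\langle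 i|H|j\rangle|^2 .$$ For a unit vector $\psi$ of a finite-dimensional system $S$ put $$\mathcal C^{1}_{F,N}(\psi)=\sup_{\Phi}\ \mathcal F\big(\Phi(|\psi\rangle\langle\psi|),\,H_N\otimes\mathbb 1_A\big),$$ the supremum being over all incoherent operations $\Phi$ from $S$ to the $N$ particles together with an ancilla $A$ of arbitrary finite dimension, and for a state $\rho$ of $S$ put $\mathcal C^1_{F,N}(\rho)=\inf\sum_k p_k\,\mathcal C^1_{F,N}(\psi_k)$, the infimum being over all finite pure-state decompositions $\rho=\sum_k p_k|\psi_k\rangle\langle\psi_k|$. **Theorem.** For every state $\rho$ of every finite-dimensional system $S$, the limit $\lim_{N\to\infty}\frac{\log\mathcal C^1_{F,N}(\rho)}{\log N}$ exists in $[-\infty,\infty]$ (with $\log 0=-\infty$), and the asymptotic QFI coherence $$\mathcal C_{AF}(\rho)=\max\Big(\lim_{N\to\infty}\frac{\log\mathcal C^1_{F,N}(\rho)}{\log N}-1,\ 0\Big)$$ equals $1$ if and only if $\rho$ is coherent, and equals $0$ if and only if $\rho$ is incoherent. -/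

import Mathlib

open Filter Topology
open scoped ENNReal NNReal Matrix Kronecker ComplexOrder

noncomputable section

/-- Density matrices on the system with (fixed, incoherent) basis labelled by `n`. -/
def IsState {n : Type*} [Fintype n] (ρ : Matrix n n ℂ) : Prop :=
  ρ.PosSemidef ∧ ρ.trace = 1

/-- Incoherent states: density matrices that are diagonal in the fixed basis. -/
def IsIncoherent {n : Type*} [Fintype n] (ρ : Matrix n n ℂ) : Prop :=
  IsState ρ ∧ ρ.IsDiag

/-- Coherent states: density matrices that are not incoherent. -/
def IsCoherent {n : Type*} [Fintype n] (ρ : Matrix n n ℂ) : Prop :=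
  IsState ρ ∧ ¬ IsIncoherent ρ

/-- `K` is a family of Kraus operators of the completely positive trace preserving map `Φ`. -/
def IsKrausFamily {m n : Type*} [Fintype m] [Fintype n] [DecidableEq m] {r : ℕ}
    (K : Fin r → Matrix n m ℂ) (Φ : Matrix m m ℂ →ₗ[ℂ] Matrix n n ℂ) : Prop :=
  (∑ k, (K k)ᴴ * K k = 1) ∧ ∀ X, Φ X = ∑ k, K k * X * (K k)ᴴ

/-- The two usual readings of "incoherent operation". -/
inductive IncoherentOpClass
  /-- CPTP maps that send every incoherent state to an incoherent state. -/
  | preserving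
  /-- CPTP maps with Kraus operators each of which keeps incoherent states diagonal. -/
  | kraus

/-- Incoherent completely positive trace preserving maps, for either reading. -/
def IsICPTP {m n : Type*} [Fintype m] [Fintype n] [DecidableEq m] (c : IncoherentOpClass)
    (Φ : Matrix m m ℂ →ₗ[ℂ] Matrix n n ℂ) : Prop :=
  match c with
  | .preserving =>
      (∃ (r : ℕ) (K : Fin r → Matrix n m ℂ), IsKrausFamily K Φ) ∧
        ∀ σ : Matrix m m ℂ, IsIncoherent σ → IsIncoherent (Φ σ)
  | .kraus =>
      ∃ (r : ℕ) (K : Fin r → Matrix n m ℂ), IsKrausFamily K Φ ∧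
        ∀ k (σ : Matrix m m ℂ), IsIncoherent σ → (K k * σ * (K k)ᴴ).IsDiag

/-- Quantum Fisher information
`2 ∑ i j, (λᵢ - λⱼ)² / (λᵢ + λⱼ) |⟨i| H |j⟩|²`, where `λᵢ`, `|i⟩` are the eigenvalues and an
orthonormal eigenbasis (the columns of `U`) of `ρ`; as usual only the terms with `λᵢ + λⱼ ≠ 0`
count. The value `0` for non-Hermitian `ρ` is a dummy value. -/
def qfi {n : Type*} [Fintype n] [DecidableEq n] (ρ H : Matrix n n ℂ) : ℝ :=
  open scoped Classical in
  if hρ : ρ.IsHermitian then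
    let lam : n → ℝ := hρ.eigenvalues
    let U : Matrix n n ℂ := (hρ.eigenvectorUnitary : Matrix n n ℂ)
    2 * ∑ i, ∑ j, (lam i - lam j) ^ 2 / (lam i + lam j) * ‖(Uᴴ * H * U) i j‖ ^ 2
  else 0

/-- Labels of the product basis of the first `N` particles, the `i`-th of dimension `d i`. -/
abbrev Config (d : ℕ → ℕ) (N : ℕ) : Type := (i : Fin N) → Fin (d i)

/-- The operator acting as `A` on particle `i` and as the identity on all other particles. -/
def localOp {d : ℕ → ℕ} {N : ℕ} (i : Fin N) (A : Matrix (Fin (d i)) (Fin (d i)) ℂ) :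
    Matrix (Config d N) (Config d N) ℂ :=
  Matrix.of fun x y => if ∀ j, j ≠ i → x j = y j then A (x i) (y i) else 0

/-- The signal Hamiltonian `∑_{i < N} h⁽ⁱ⁾` on `N` particles. -/
def signalHamiltonian {d : ℕ → ℕ} (h : (i : ℕ) → Matrix (Fin (d i)) (Fin (d i)) ℂ) (N : ℕ) :
    Matrix (Config d N) (Config d N) ℂ :=
  ∑ i : Fin N, localOp i (h i)

/-- The diameter of the spectrum; for a Hermitian matrix, its largest minus its smallest
eigenvalue. -/
def spectralSpread {n : Type*} [Fintype n] [DecidableEq n] (A : Matrix n n ℂ) : ℝ :=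
  Metric.diam (spectrum ℂ A)

/-- The rank one operator `|ψ⟩⟨ψ|`. -/
def ketbra {n : Type*} (ψ : n → ℂ) : Matrix n n ℂ :=
  Matrix.vecMulVec ψ (star ψ)

/-- `C_F^1` of a pure state: the supremum of the quantum Fisher information with respect to the
`N`-particle signal Hamiltonian over all incoherent operations, whose output consists of the `N`
particles together with an ancilla of any finite dimension `a` that the signal does not touch. -/
def qfiCoherencePure {S : Type*} [Fintype S] [DecidableEq S] {d : ℕ → ℕ} (c : IncoherentOpClass)
    (h : (i : ℕ) → Matrix (Fin (d i)) (Fin (d i)) ℂ) (N : ℕ) (ψ : S → ℂ) : ℝ≥0∞ :=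
  ⨆ (a : ℕ) (Φ : Matrix S S ℂ →ₗ[ℂ] Matrix (Config d N × Fin a) (Config d N × Fin a) ℂ)
    (_ : IsICPTP c Φ),
    ENNReal.ofReal
      (qfi (Φ (ketbra ψ)) (signalHamiltonian h N ⊗ₖ (1 : Matrix (Fin a) (Fin a) ℂ)))

/-- `ρ = ∑ₖ pₖ |ψₖ⟩⟨ψₖ|` with a probability vector `p` and unit vectors `ψₖ`. -/
def IsPureDecomposition {S : Type*} [Fintype S] (ρ : Matrix S S ℂ) {r : ℕ}
    (p : Fin r → ℝ≥0) (ψ : Fin r → S → ℂ) : Prop :=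
  ∑ k, p k = 1 ∧ (∀ k, ∑ s, ‖ψ k s‖ ^ 2 = 1) ∧ ρ = ∑ k, ((p k : ℝ) : ℂ) • ketbra (ψ k)

/-- `C_F^1` of a mixed state: the convex roof of `qfiCoherencePure`. -/
def qfiCoherence {S : Type*} [Fintype S] [DecidableEq S] {d : ℕ → ℕ} (c : IncoherentOpClass)
    (h : (i : ℕ) → Matrix (Fin (d i)) (Fin (d i)) ℂ) (N : ℕ) (ρ : Matrix S S ℂ) : ℝ≥0∞ :=
  ⨅ (r : ℕ) (p : Fin r → ℝ≥0) (ψ : Fin r → S → ℂ) (_ : IsPureDecomposition ρ p ψ),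
    ∑ k, (p k : ℝ≥0∞) * qfiCoherencePure c h N (ψ k)

/-- `log C_F^1(ρ) / log N` as an extended real number, with `log 0 = -∞`. -/
def qfiLogRatio {S : Type*} [Fintype S] [DecidableEq S] {d : ℕ → ℕ} (c : IncoherentOpClass)
    (h : (i : ℕ) → Matrix (Fin (d i)) (Fin (d i)) ℂ) (ρ : Matrix S S ℂ) (N : ℕ) : EReal :=
  ENNReal.log (qfiCoherence c h N ρ) / ENNReal.log (N : ℝ≥0∞)

/-- The asymptotic QFI coherence `max (lim_N log C_F^1(ρ) / log N - 1, 0)`. -/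
def asymptoticQFICoherence {S : Type*} [Fintype S] [DecidableEq S] {d : ℕ → ℕ}
    (c : IncoherentOpClass) (h : (i : ℕ) → Matrix (Fin (d i)) (Fin (d i)) ℂ)
    (ρ : Matrix S S ℂ) : EReal :=
  max (limUnder atTop (qfiLogRatio c h ρ) - 1) 0

end

/-!
For a state `ρ` the quantum Fisher information lies between `2 ‖[ρ, H]‖²` (Frobenius norm) and four
times the second moment of `H`, and it is unchanged when a multiple of `1` is added to `H`. So the
square of the spectral spread of the signal Hamiltonian bounds `C_F^1` from above up to a constant.
Conversely, an off-diagonal entry `ρ s t` can be carried, by an incoherent operation keeping `|u⟩`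
in the ancilla, to an entry between configurations of lowest and highest energy, and the commutator
bound turns it into a multiple of the same square; by Jensen's inequality this lower bound passes
to the convex roof. Hence `C_F^1` of a coherent state grows like `N²`. A diagonal state is a mixture
of basis states, and these have `C_F^1 = 0` because diagonal outputs commute with the signal.
-/

section Eigenbasis

theorem mul_conjTranspose_self_apply_self {m n : Type*} [Fintype n] (A : Matrix m n ℂ) (i : m) :
    (A * Aᴴ) i i = ((∑ j, ‖A i j‖ ^ 2 : ℝ) : ℂ) := by
  simp [Matrix.mul_apply, Complex.mul_conj']

theorem conjTranspose_mul_self_apply_self {m n : Type*} [Fintype m] (A : Matrix m n ℂ) (j : n) :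
    (Aᴴ * A) j j = ((∑ i, ‖A i j‖ ^ 2 : ℝ) : ℂ) := by
  simp [Matrix.mul_apply, Complex.conj_mul']

variable {n : Type*} [Fintype n] [DecidableEq n] {ρ : Matrix n n ℂ}

/-- The change of basis `X ↦ Uᴴ X U` to the eigenbasis of `ρ` in which `qfi` is written; the
columns of `U` are the eigenvectors of `ρ`. -/
noncomputable def toEigenbasis (hρ : ρ.IsHermitian) : Matrix n n ℂ ≃⋆ₐ[ℂ] Matrix n n ℂ :=
  Unitary.conjStarAlgAut ℂ _ (star hρ.eigenvectorUnitary)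

theorem toEigenbasis_self (hρ : ρ.IsHermitian) :
    toEigenbasis hρ ρ = Matrix.diagonal fun i => (hρ.eigenvalues i : ℂ) :=
  hρ.conjStarAlgAut_star_eigenvectorUnitary

theorem trace_toEigenbasis (hρ : ρ.IsHermitian) (X : Matrix n n ℂ) :
    (toEigenbasis hρ X).trace = X.trace := by
  rw [toEigenbasis, Unitary.conjStarAlgAut_star_apply, Matrix.trace_mul_cycle,
    Unitary.mul_star_self_of_mem hρ.eigenvectorUnitary.2, one_mul]

theorem toEigenbasis_lie_apply (hρ : ρ.IsHermitian) (H : Matrix n n ℂ) (i j : n) :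
    toEigenbasis hρ ⁅ρ, H⁆ i j =
      ((hρ.eigenvalues i - hρ.eigenvalues j : ℝ) : ℂ) * toEigenbasis hρ H i j := by
  rw [Ring.lie_def, map_sub, map_mul, map_mul, toEigenbasis_self, Matrix.sub_apply,
    Matrix.diagonal_mul, Matrix.mul_diagonal]
  push_cast
  ring

theorem trace_mul_eq_sum_eigenvalues_mul_toEigenbasis (hρ : ρ.IsHermitian) (X : Matrix n n ℂ) :
    (ρ * X).trace = ∑ i, (hρ.eigenvalues i : ℂ) * toEigenbasis hρ X i i := by
  rw [← trace_toEigenbasis hρ, map_mul, toEigenbasis_self]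
  simp only [Matrix.trace, Matrix.diag_apply, Matrix.diagonal_mul]

theorem sum_norm_sq_toEigenbasis (hρ : ρ.IsHermitian) (X : Matrix n n ℂ) :
    ∑ i, ∑ j, ‖toEigenbasis hρ X i j‖ ^ 2 = ∑ i, ∑ j, ‖X i j‖ ^ 2 := by
  have trace_eq (Y : Matrix n n ℂ) : (Y * Yᴴ).trace = ((∑ i, ∑ j, ‖Y i j‖ ^ 2 : ℝ) : ℂ) := by
    simp only [Matrix.trace, Matrix.diag_apply, mul_conjTranspose_self_apply_self,
      Complex.ofReal_sum]
  have h := trace_toEigenbasis hρ (X * Xᴴ)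
  rw [map_mul, ← Matrix.star_eq_conjTranspose, map_star, Matrix.star_eq_conjTranspose,
    Matrix.star_eq_conjTranspose, trace_eq, trace_eq] at h
  exact_mod_cast h

theorem sum_eigenvalues_add_mul_norm_sq_toEigenbasis (hρ : ρ.IsHermitian) (H : Matrix n n ℂ) :
    ∑ i, ∑ j, (hρ.eigenvalues i + hρ.eigenvalues j) * ‖toEigenbasis hρ H i j‖ ^ 2 =
      (ρ * (H * Hᴴ + Hᴴ * H)).trace.re := by
  have hrow (i : n) : toEigenbasis hρ (H * Hᴴ) i i =
      ((∑ j, ‖toEigenbasis hρ H i j‖ ^ 2 : ℝ) : ℂ) := by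
    rw [map_mul, ← Matrix.star_eq_conjTranspose, map_star, Matrix.star_eq_conjTranspose,
      mul_conjTranspose_self_apply_self]
  have hcol (j : n) : toEigenbasis hρ (Hᴴ * H) j j =
      ((∑ i, ‖toEigenbasis hρ H i j‖ ^ 2 : ℝ) : ℂ) := by
    rw [map_mul, ← Matrix.star_eq_conjTranspose, map_star, Matrix.star_eq_conjTranspose,
      conjTranspose_mul_self_apply_self]
  rw [mul_add, Matrix.trace_add, trace_mul_eq_sum_eigenvalues_mul_toEigenbasis hρ,
    trace_mul_eq_sum_eigenvalues_mul_toEigenbasis hρ, Complex.add_re, Complex.re_sum,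
    Complex.re_sum]
  simp only [hrow, hcol, ← Complex.ofReal_mul, Complex.ofReal_re, Finset.mul_sum, add_mul,
    Finset.sum_add_distrib]
  congr 1
  exact Finset.sum_comm

end Eigenbasis

section States

variable {n : Type*} [Fintype n] {ρ : Matrix n n ℂ}

theorem IsState.nonempty (hρ : IsState ρ) : Nonempty n := by
  by_contra hn
  rw [not_nonempty_iff] at hn
  exact zero_ne_one ((Matrix.trace_eq_zero_of_isEmpty ρ).symm.trans hρ.2)

theorem IsState.re_apply_self_nonneg (hρ : IsState ρ) (x : n) : 0 ≤ (ρ x x).re :=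
  (Complex.le_def.1 hρ.1.diag_nonneg).1

theorem IsState.sum_re_apply_self (hρ : IsState ρ) : ∑ x, (ρ x x).re = 1 := by
  simpa [Matrix.trace] using congrArg Complex.re hρ.2

theorem IsCoherent.exists_ne_apply_ne_zero (hρ : IsCoherent ρ) : ∃ s t, s ≠ t ∧ ρ s t ≠ 0 := by
  by_contra! h
  exact hρ.2 ⟨hρ.1, h⟩

theorem isState_ketbra {ψ : n → ℂ} (hψ : ∑ s, ‖ψ s‖ ^ 2 = 1) : IsState (ketbra ψ) := by
  refine ⟨Matrix.posSemidef_vecMulVec_self_star ψ, ?_⟩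
  simp only [ketbra, Matrix.trace, Matrix.diag_apply, Matrix.vecMulVec_apply, Pi.star_apply,
    RCLike.star_def, Complex.mul_conj']
  exact_mod_cast hψ

theorem enorm_sq_apply_le_of_isPureDecomposition {r : ℕ} {p : Fin r → ℝ≥0} {ψ : Fin r → n → ℂ}
    (hdec : IsPureDecomposition ρ p ψ) (s t : n) :
    ‖ρ s t‖ₑ ^ 2 ≤ ∑ k, (p k : ℝ≥0∞) * ‖ketbra (ψ k) s t‖ₑ ^ 2 := by
  have htriangle : ‖ρ s t‖₊ ≤ ∑ k, p k * ‖ketbra (ψ k) s t‖₊ := by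
    rw [hdec.2.2, Matrix.sum_apply]
    refine (nnnorm_sum_le _ _).trans_eq (Finset.sum_congr rfl fun k _ => ?_)
    simp
  have hjensen := (pow_le_pow_left₀ zero_le htriangle 2).trans
    (NNReal.pow_arith_mean_le_arith_mean_pow _ _ _ hdec.1 2)
  simp only [enorm_eq_nnnorm]
  exact_mod_cast hjensen

variable [DecidableEq n]

theorem IsState.sum_eigenvalues (hρ : IsState ρ) : ∑ i, hρ.1.isHermitian.eigenvalues i = 1 := by
  have h : ((∑ i, hρ.1.isHermitian.eigenvalues i : ℝ) : ℂ) = 1 := by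
    rw [Complex.ofReal_sum]
    exact hρ.1.isHermitian.trace_eq_sum_eigenvalues.symm.trans hρ.2
  exact_mod_cast h

theorem IsState.eigenvalues_add_le_one (hρ : IsState ρ) {i j : n} (hij : i ≠ j) :
    hρ.1.isHermitian.eigenvalues i + hρ.1.isHermitian.eigenvalues j ≤ 1 := by
  rw [← hρ.sum_eigenvalues, ← Finset.sum_pair hij]
  exact Finset.sum_le_univ_sum_of_nonneg hρ.1.eigenvalues_nonneg

theorem sum_norm_sq_single (s : n) : ∑ t, ‖(Pi.single s 1 : n → ℂ) t‖ ^ 2 = 1 := by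
  simp [Pi.single_apply, apply_ite]

theorem ketbra_single {m : Type*} [DecidableEq m] (s : m) :
    ketbra (Pi.single s (1 : ℂ)) = Matrix.single s s 1 := by
  simp [ketbra, Matrix.single_eq_single_vecMulVec_single, Pi.star_single]

theorem isIncoherent_ketbra_single (s : n) : IsIncoherent (ketbra (Pi.single s (1 : ℂ))) := by
  refine ⟨isState_ketbra (sum_norm_sq_single s), ?_⟩
  rw [ketbra_single, ← Matrix.diagonal_single]
  exact Matrix.isDiag_diagonal _

theorem eq_sum_smul_ketbra_eigenvectors (hρ : ρ.IsHermitian) :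
    ρ = ∑ i, (hρ.eigenvalues i : ℂ) •
      ketbra ((hρ.eigenvectorUnitary : Matrix n n ℂ).col i) := by
  conv_lhs => rw [hρ.spectral_theorem, Unitary.conjStarAlgAut_apply]
  ext x y
  simp only [Matrix.mul_apply (N := star _), Matrix.mul_diagonal, Matrix.sum_apply, ketbra,
    Matrix.smul_apply, Matrix.vecMulVec_apply, Function.comp_apply, smul_eq_mul,
    Matrix.star_apply, Pi.star_apply, Matrix.col_apply]
  exact Finset.sum_congr rfl fun i _ => by simp only [RCLike.ofReal_eq_complex_ofReal]; ring

theorem sum_norm_sq_eigenvectorUnitary_col (hρ : ρ.IsHermitian) (i : n) :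
    ∑ x, ‖(hρ.eigenvectorUnitary : Matrix n n ℂ).col i x‖ ^ 2 = 1 := by
  have h := conjTranspose_mul_self_apply_self (hρ.eigenvectorUnitary : Matrix n n ℂ) i
  rw [← Matrix.star_eq_conjTranspose, Unitary.coe_star_mul_self, Matrix.one_apply_eq] at h
  exact_mod_cast h.symm

theorem IsIncoherent.eq_sum_smul_ketbra_single (hρ : IsIncoherent ρ) :
    ρ = ∑ s, ((ρ s s).re : ℂ) • ketbra (Pi.single s (1 : ℂ)) := by
  have hre (s : n) : ((ρ s s).re : ℂ) = ρ s s := hρ.1.1.isHermitian.coe_re_apply_self s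
  simp only [hre, ketbra_single, Matrix.smul_single, smul_eq_mul, mul_one]
  rw [Matrix.sum_single_eq_diagonal]
  exact hρ.2.diagonal_diag.symm

end States

section QFI

variable {n : Type*} [Fintype n] [DecidableEq n] {ρ H : Matrix n n ℂ}

theorem qfi_eq_sum_toEigenbasis (hρ : ρ.IsHermitian) (H : Matrix n n ℂ) :
    qfi ρ H = 2 * ∑ i, ∑ j, (hρ.eigenvalues i - hρ.eigenvalues j) ^ 2 /
      (hρ.eigenvalues i + hρ.eigenvalues j) * ‖toEigenbasis hρ H i j‖ ^ 2 := by
  rw [qfi, dif_pos hρ]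
  simp only [toEigenbasis, Unitary.conjStarAlgAut_star_apply, Matrix.star_eq_conjTranspose]

theorem qfi_eq_zero_of_commute (hρ : ρ.IsHermitian) (hc : Commute ρ H) : qfi ρ H = 0 := by
  rw [qfi_eq_sum_toEigenbasis hρ, mul_eq_zero_of_right]
  refine Finset.sum_eq_zero fun i _ => Finset.sum_eq_zero fun j _ => ?_
  have h := toEigenbasis_lie_apply hρ H i j
  rw [hc.lie_eq, map_zero, Matrix.zero_apply, zero_eq_mul, Complex.ofReal_eq_zero] at h
  rcases h with h | h <;> simp [h]

theorem qfi_sub_smul_one (hρ : ρ.IsHermitian) (H : Matrix n n ℂ) (c : ℂ) :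
    qfi ρ (H - c • 1) = qfi ρ H := by
  rw [qfi_eq_sum_toEigenbasis hρ, qfi_eq_sum_toEigenbasis hρ]
  congr 1
  refine Finset.sum_congr rfl fun i _ => Finset.sum_congr rfl fun j _ => ?_
  obtain rfl | hij := eq_or_ne i j
  · simp
  · simp [map_sub, map_smul, Matrix.one_apply_ne hij]

/-- For Hermitian `H` the right-hand side is four times the second moment of `H`. -/
theorem qfi_le_two_mul_trace (hρ : ρ.PosSemidef) (H : Matrix n n ℂ) :
    qfi ρ H ≤ 2 * (ρ * (H * Hᴴ + Hᴴ * H)).trace.re := by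
  rw [qfi_eq_sum_toEigenbasis hρ.isHermitian,
    ← sum_eigenvalues_add_mul_norm_sq_toEigenbasis hρ.isHermitian]
  gcongr with i _ j _
  have hi := hρ.eigenvalues_nonneg i
  have hj := hρ.eigenvalues_nonneg j
  refine div_le_of_le_mul₀ (by positivity) (by positivity) ?_
  nlinarith [mul_nonneg hi hj]

/-- The factors `λᵢ + λⱼ ≤ 1` are dropped from the denominators, and the Frobenius norm does not
depend on the basis. -/
theorem two_mul_sum_norm_sq_lie_le_qfi (hρ : IsState ρ) (H : Matrix n n ℂ) :
    2 * ∑ i, ∑ j, ‖⁅ρ, H⁆ i j‖ ^ 2 ≤ qfi ρ H := by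
  rw [qfi_eq_sum_toEigenbasis hρ.1.isHermitian, ← sum_norm_sq_toEigenbasis hρ.1.isHermitian]
  gcongr with i _ j _
  rw [toEigenbasis_lie_apply, norm_mul, mul_pow, Complex.norm_real, Real.norm_eq_abs, sq_abs]
  gcongr
  have hi := hρ.1.eigenvalues_nonneg i
  have hj := hρ.1.eigenvalues_nonneg j
  obtain rfl | hij := eq_or_ne i j
  · simp
  obtain hsum | hsum := (add_nonneg hi hj).eq_or_lt
  · obtain ⟨hi₀, hj₀⟩ := (add_eq_zero_iff_of_nonneg hi hj).1 hsum.symm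
    simp [hi₀, hj₀]
  · exact le_div_self (sq_nonneg _) hsum (hρ.eigenvalues_add_le_one hij)

theorem lie_apply_of_isDiag {m R : Type*} [Fintype m] [CommRing R] {D : Matrix m m R}
    (X : Matrix m m R) (hD : D.IsDiag) (x y : m) : ⁅X, D⁆ x y = X x y * (D y y - D x x) := by
  classical
  rw [Ring.lie_def, ← hD.diagonal_diag, Matrix.sub_apply, Matrix.mul_diagonal,
    Matrix.diagonal_mul, Matrix.diagonal_apply_eq, Matrix.diagonal_apply_eq]
  ring

theorem commute_of_isDiag {m R : Type*} [Fintype m] [CommSemiring R] {D E : Matrix m m R}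
    (hD : D.IsDiag) (hE : E.IsDiag) : Commute D E := by
  classical
  rw [← hD.diagonal_diag, ← hE.diagonal_diag]
  exact Matrix.commute_diagonal _ _

theorem two_mul_norm_sq_mul_norm_sq_le_qfi (hρ : IsState ρ) (hH : H.IsDiag) (x y : n) :
    2 * (‖ρ x y‖ ^ 2 * ‖H y y - H x x‖ ^ 2) ≤ qfi ρ H := by
  refine le_trans ?_ (two_mul_sum_norm_sq_lie_le_qfi hρ H)
  rw [← mul_pow, ← norm_mul, ← lie_apply_of_isDiag ρ hH]
  gcongr
  calc ‖⁅ρ, H⁆ x y‖ ^ 2 ≤ ∑ j, ‖⁅ρ, H⁆ x j‖ ^ 2 :=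
        Finset.single_le_sum (f := fun j => ‖⁅ρ, H⁆ x j‖ ^ 2) (fun _ _ => by positivity)
          (Finset.mem_univ y)
    _ ≤ ∑ i, ∑ j, ‖⁅ρ, H⁆ i j‖ ^ 2 :=
        Finset.single_le_sum (f := fun i => ∑ j, ‖⁅ρ, H⁆ i j‖ ^ 2) (fun _ _ => by positivity)
          (Finset.mem_univ x)

theorem qfi_le_four_mul_sq_of_norm_le (hρ : IsState ρ) (hH : H.IsDiag) {B : ℝ}
    (hB : ∀ x, ‖H x x‖ ≤ B) : qfi ρ H ≤ 4 * B ^ 2 := by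
  have hmul : H * Hᴴ + Hᴴ * H = Matrix.diagonal fun x => ((2 * ‖H x x‖ ^ 2 : ℝ) : ℂ) := by
    conv_lhs => rw [← hH.diagonal_diag, Matrix.diagonal_conjTranspose]
    rw [Matrix.diagonal_mul_diagonal, Matrix.diagonal_mul_diagonal, Matrix.diagonal_add]
    congr! 2 with x
    simp only [Pi.star_apply, Matrix.diag_apply, RCLike.star_def, Complex.mul_conj',
      Complex.conj_mul']
    push_cast
    ring
  calc qfi ρ H ≤ 2 * (ρ * (H * Hᴴ + Hᴴ * H)).trace.re := qfi_le_two_mul_trace hρ.1 H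
    _ = 2 * ∑ x, (ρ x x).re * (2 * ‖H x x‖ ^ 2) := by
        simp only [hmul, Matrix.trace, Matrix.diag_apply, Matrix.mul_diagonal, Complex.re_sum,
          Complex.re_mul_ofReal]
    _ ≤ 2 * ∑ x, (ρ x x).re * (2 * B ^ 2) := by
        gcongr with x
        · exact hρ.re_apply_self_nonneg x
        · exact hB x
    _ = 4 * B ^ 2 := by rw [← Finset.sum_mul, hρ.sum_re_apply_self]; ring

end QFI

section Hamiltonian

variable {n : Type*} [Fintype n] [DecidableEq n] {A : Matrix n n ℂ}

theorem dist_le_spectralSpread (hA : A.IsDiag) (x y : n) :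
    dist (A x x) (A y y) ≤ spectralSpread A := by
  rw [← hA.diagonal_diag, spectralSpread, spectrum_diagonal]
  refine Metric.dist_le_diam_of_mem (Set.finite_range _).isBounded ⟨x, ?_⟩ ⟨y, ?_⟩ <;> simp

theorem spectralSpread_le (hA : A.IsDiag) {B : ℝ} (hB : 0 ≤ B)
    (h : ∀ x y, dist (A x x) (A y y) ≤ B) : spectralSpread A ≤ B := by
  rw [← hA.diagonal_diag, spectralSpread, spectrum_diagonal]
  refine Metric.diam_le_of_forall_dist_le hB ?_
  rintro _ ⟨x, rfl⟩ _ ⟨y, rfl⟩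
  exact h x y

theorem exists_sub_eq_spectralSpread [Nonempty n] (hA : A.IsDiag) (hA' : A.IsHermitian) :
    ∃ x y, A y y - A x x = spectralSpread A := by
  obtain ⟨x, hx⟩ := Finite.exists_min fun z => (A z z).re
  obtain ⟨y, hy⟩ := Finite.exists_max fun z => (A z z).re
  have hdist (u v : n) : dist (A u u) (A v v) = |(A u u).re - (A v v).re| := by
    rw [← hA'.coe_re_apply_self u, ← hA'.coe_re_apply_self v]
    exact Complex.isometry_ofReal.dist_eq _ _
  have hspread : spectralSpread A = (A y y).re - (A x x).re := by
    refine le_antisymm (spectralSpread_le hA (sub_nonneg.2 (hx y)) fun u v => ?_) ?_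
    · rw [hdist, abs_le]
      constructor <;> linarith [hx u, hx v, hy u, hy v]
    · exact (le_abs_self _).trans ((hdist y x).ge.trans (dist_le_spectralSpread hA y x))
  refine ⟨x, y, ?_⟩
  rw [hspread, Complex.ofReal_sub]
  exact congrArg₂ (· - ·) (hA'.coe_re_apply_self y).symm (hA'.coe_re_apply_self x).symm

theorem nonempty_of_spectralSpread_pos (hA : 0 < spectralSpread A) : Nonempty n := by
  by_contra hn
  rw [not_nonempty_iff] at hn
  simp [spectralSpread, spectrum.of_subsingleton] at hA

theorem isDiag_sum {ι m R : Type*} [AddCommMonoid R] {s : Finset ι} {D : ι → Matrix m m R}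
    (hD : ∀ i ∈ s, (D i).IsDiag) : (∑ i ∈ s, D i).IsDiag := by
  intro x y hxy
  rw [Matrix.sum_apply]
  exact Finset.sum_eq_zero fun i hi => hD i hi hxy

variable {d : ℕ → ℕ} {h : (i : ℕ) → Matrix (Fin (d i)) (Fin (d i)) ℂ}

theorem isDiag_localOp {N : ℕ} (i : Fin N) {B : Matrix (Fin (d i)) (Fin (d i)) ℂ}
    (hB : B.IsDiag) : (localOp i B).IsDiag := by
  intro x y hxy
  simp only [localOp, Matrix.of_apply, ite_eq_right_iff]
  refine fun hj => hB fun hi => hxy (funext fun j => ?_)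
  obtain rfl | hji := eq_or_ne j i
  · exact hi
  · exact hj j hji

theorem isHermitian_localOp {N : ℕ} (i : Fin N) {B : Matrix (Fin (d i)) (Fin (d i)) ℂ}
    (hB : B.IsHermitian) : (localOp i B).IsHermitian := by
  refine Matrix.IsHermitian.ext fun x y => ?_
  simp only [localOp, Matrix.of_apply, eq_comm (a := y _), apply_ite star, star_zero, hB.apply]

theorem isDiag_signalHamiltonian (h_diag : ∀ i, (h i).IsDiag) (N : ℕ) :
    (signalHamiltonian h N).IsDiag :=
  isDiag_sum fun i _ => isDiag_localOp i (h_diag i)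

theorem isHermitian_signalHamiltonian (h_herm : ∀ i, (h i).IsHermitian) (N : ℕ) :
    (signalHamiltonian h N).IsHermitian :=
  isSelfAdjoint_sum _ fun i _ => isHermitian_localOp i (h_herm i)

theorem signalHamiltonian_apply_self (N : ℕ) (x : Config d N) :
    signalHamiltonian h N x x = ∑ i : Fin N, h i (x i) (x i) := by
  simp [signalHamiltonian, Matrix.sum_apply, localOp]

theorem spectralSpread_signalHamiltonian [∀ i, NeZero (d i)] (h_herm : ∀ i, (h i).IsHermitian)
    (h_diag : ∀ i, (h i).IsDiag) (N : ℕ) :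
    spectralSpread (signalHamiltonian h N) = ∑ i : Fin N, spectralSpread (h i) := by
  have hH := isDiag_signalHamiltonian h_diag N
  have hnonneg : 0 ≤ ∑ i : Fin N, spectralSpread (h i) :=
    Finset.sum_nonneg fun i _ => Metric.diam_nonneg
  refine le_antisymm (spectralSpread_le hH hnonneg fun x y => ?_) ?_
  · simp only [signalHamiltonian_apply_self]
    exact (dist_sum_sum_le _ _ _).trans
      (Finset.sum_le_sum fun i _ => dist_le_spectralSpread (h_diag i) _ _)
  · choose x y hxy using fun i => exists_sub_eq_spectralSpread (h_diag i) (h_herm i)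
    have hgap := dist_le_spectralSpread hH (fun i => y i) (fun i => x i)
    simp only [dist_eq_norm, signalHamiltonian_apply_self, ← Finset.sum_sub_distrib, hxy] at hgap
    rwa [← Complex.ofReal_sum, Complex.norm_of_nonneg hnonneg] at hgap

theorem qfi_kronecker_one_le {κ : Type*} [Fintype κ] [DecidableEq κ]
    {ρ : Matrix (n × κ) (n × κ) ℂ} (hρ : IsState ρ) (hA : A.IsDiag) :
    qfi ρ (A ⊗ₖ (1 : Matrix κ κ ℂ)) ≤ 4 * spectralSpread A ^ 2 := by
  obtain ⟨p₀⟩ := hρ.nonempty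
  rw [← qfi_sub_smul_one hρ.1.isHermitian _ (A p₀.1 p₀.1)]
  refine qfi_le_four_mul_sq_of_norm_le hρ
    ((hA.kronecker Matrix.isDiag_one).sub (Matrix.isDiag_smul_one _ _)) fun p => ?_
  simpa [dist_eq_norm] using dist_le_spectralSpread hA p.1 p₀.1

end Hamiltonian

section Operations

variable {m n : Type*} [Fintype m] [Fintype n] [DecidableEq m] {c : IncoherentOpClass}
  {Φ : Matrix m m ℂ →ₗ[ℂ] Matrix n n ℂ} {σ : Matrix m m ℂ}

theorem IsKrausFamily.isState {r : ℕ} {K : Fin r → Matrix n m ℂ} (hK : IsKrausFamily K Φ)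
    (hσ : IsState σ) : IsState (Φ σ) := by
  rw [hK.2]
  refine ⟨Matrix.posSemidef_sum _ fun k _ => hσ.1.mul_mul_conjTranspose_same (K k), ?_⟩
  calc (∑ k, K k * σ * (K k)ᴴ).trace = ((∑ k, (K k)ᴴ * K k) * σ).trace := by
        rw [Matrix.trace_sum, Finset.sum_mul, Matrix.trace_sum]
        exact Finset.sum_congr rfl fun k _ => Matrix.trace_mul_cycle _ _ _
    _ = 1 := by rw [hK.1, Matrix.one_mul, hσ.2]

theorem IsICPTP.isState (hΦ : IsICPTP c Φ) (hσ : IsState σ) : IsState (Φ σ) := by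
  cases c with
  | preserving =>
    obtain ⟨⟨_, _, hK⟩, -⟩ := hΦ
    exact hK.isState hσ
  | kraus =>
    obtain ⟨_, _, hK, -⟩ := hΦ
    exact hK.isState hσ

theorem IsICPTP.isIncoherent (hΦ : IsICPTP c Φ) (hσ : IsIncoherent σ) : IsIncoherent (Φ σ) := by
  cases c with
  | preserving => exact hΦ.2 σ hσ
  | kraus =>
    refine ⟨hΦ.isState hσ.1, ?_⟩
    obtain ⟨r, K, hK, hdiag⟩ := hΦ
    rw [hK.2]
    exact isDiag_sum fun k _ => hdiag k σ hσ

theorem IsICPTP.of_kraus (c : IncoherentOpClass) {r : ℕ} {K : Fin r → Matrix n m ℂ}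
    (hK : IsKrausFamily K Φ)
    (hdiag : ∀ k (σ : Matrix m m ℂ), IsIncoherent σ → (K k * σ * (K k)ᴴ).IsDiag) :
    IsICPTP c Φ := by
  have h : IsICPTP .kraus Φ := ⟨r, K, hK, hdiag⟩
  cases c with
  | preserving => exact ⟨⟨r, K, hK⟩, fun σ hσ => h.isIncoherent hσ⟩
  | kraus => exact h

end Operations

section Relabelling

variable {m n : Type*} [DecidableEq n] {f : m → n}

/-- The matrix `V = ∑ u, |f u⟩⟨u|`, an isometry when the relabelling `f` is injective. -/
def relabelMatrix (f : m → n) : Matrix n m ℂ :=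
  (1 : Matrix n n ℂ).submatrix id f

theorem relabelMatrix_apply (f : m → n) (z : n) (u : m) :
    relabelMatrix f z u = if z = f u then 1 else 0 :=
  Matrix.one_apply

theorem conjTranspose_relabelMatrix_mul_self [Fintype n] [DecidableEq m] (hf : f.Injective) :
    (relabelMatrix f)ᴴ * relabelMatrix f = 1 := by
  rw [relabelMatrix, Matrix.conjTranspose_submatrix, Matrix.conjTranspose_one,
    ← Matrix.submatrix_mul _ _ f id f Function.bijective_id, mul_one, Matrix.submatrix_one f hf]

variable [Fintype m]

/-- The operation `X ↦ V X Vᴴ` that prepares the basis state `|f u⟩` from the basis state `|u⟩`;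
it is an incoherent operation when `f` is injective. -/
def relabelOp (f : m → n) : Matrix m m ℂ →ₗ[ℂ] Matrix n n ℂ where
  toFun X := relabelMatrix f * X * (relabelMatrix f)ᴴ
  map_add' X Y := by rw [Matrix.mul_add, Matrix.add_mul]
  map_smul' c X := by rw [Matrix.mul_smul, Matrix.smul_mul, RingHom.id_apply]

theorem relabelOp_apply_apply (hf : f.Injective) (X : Matrix m m ℂ) (s t : m) :
    relabelOp f X (f s) (f t) = X s t := by
  classical
  simp [relabelOp, Matrix.mul_apply, relabelMatrix_apply, hf.eq_iff]

theorem isDiag_relabelOp (f : m → n) {X : Matrix m m ℂ} (hX : X.IsDiag) :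
    (relabelOp f X).IsDiag := by
  classical
  intro z w hzw
  rw [← hX.diagonal_diag]
  simp only [relabelOp, LinearMap.coe_mk, AddHom.coe_mk, Matrix.mul_apply (M := _ * _),
    Matrix.mul_diagonal, Matrix.conjTranspose_apply, relabelMatrix_apply]
  refine Finset.sum_eq_zero fun u _ => ?_
  by_cases hz : z = f u
  · simp [← hz, hzw.symm]
  · simp [hz]

theorem isICPTP_relabelOp [Fintype n] [DecidableEq m] (c : IncoherentOpClass)
    (hf : f.Injective) : IsICPTP c (relabelOp f) := by
  refine .of_kraus c (K := fun _ : Fin 1 => relabelMatrix f) ⟨?_, fun X => ?_⟩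
    fun _ σ hσ => isDiag_relabelOp f hσ.2
  · rw [Fin.sum_univ_one, conjTranspose_relabelMatrix_mul_self hf]
  · rw [Fin.sum_univ_one]
    rfl

end Relabelling

section Coherence

variable {S : Type*} [Fintype S] [DecidableEq S] {d : ℕ → ℕ}
  {h : (i : ℕ) → Matrix (Fin (d i)) (Fin (d i)) ℂ} {ρ : Matrix S S ℂ}

theorem qfiCoherencePure_le (c : IncoherentOpClass) (h_diag : ∀ i, (h i).IsDiag) (N : ℕ)
    {ψ : S → ℂ} (hψ : ∑ s, ‖ψ s‖ ^ 2 = 1) :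
    qfiCoherencePure c h N ψ ≤ ENNReal.ofReal (4 * spectralSpread (signalHamiltonian h N) ^ 2) :=
  iSup_le fun _ => iSup_le fun _ => iSup_le fun hΦ => ENNReal.ofReal_le_ofReal <|
    qfi_kronecker_one_le (hΦ.isState (isState_ketbra hψ)) (isDiag_signalHamiltonian h_diag N)

theorem qfiCoherencePure_eq_zero (c : IncoherentOpClass) (h_diag : ∀ i, (h i).IsDiag) (N : ℕ)
    {ψ : S → ℂ} (hψ : IsIncoherent (ketbra ψ)) : qfiCoherencePure c h N ψ = 0 := by
  simp only [qfiCoherencePure, ENNReal.iSup_eq_zero]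
  intro a Φ hΦ
  have hσ := hΦ.isIncoherent hψ
  rw [qfi_eq_zero_of_commute hσ.1.1.isHermitian, ENNReal.ofReal_zero]
  exact commute_of_isDiag hσ.2
    ((isDiag_signalHamiltonian h_diag N).kronecker Matrix.isDiag_one)

/-- The extremal operation is `|u⟩ ↦ |y⟩|u⟩` for `u = t` and `|u⟩ ↦ |x⟩|u⟩` otherwise, where `x` and
`y` are configurations of extremal energy. -/
theorem le_qfiCoherencePure (c : IncoherentOpClass) (h_herm : ∀ i, (h i).IsHermitian)
    (h_diag : ∀ i, (h i).IsDiag) (N : ℕ) {ψ : S → ℂ} (hψ : ∑ s, ‖ψ s‖ ^ 2 = 1) {s t : S}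
    (hst : s ≠ t) :
    ENNReal.ofReal (2 * spectralSpread (signalHamiltonian h N) ^ 2) * ‖ketbra ψ s t‖ₑ ^ 2 ≤
      qfiCoherencePure c h N ψ := by
  obtain hempty | hne := isEmpty_or_nonempty (Config d N)
  · simp [spectralSpread, spectrum.of_subsingleton]
  have hH := isDiag_signalHamiltonian h_diag N
  obtain ⟨x, y, hxy⟩ := exists_sub_eq_spectralSpread hH (isHermitian_signalHamiltonian h_herm N)
  let f (u : S) : Config d N × Fin (Fintype.card S) :=
    (if u = t then y else x, Fintype.equivFin S u)
  have hf : f.Injective := fun u v huv => (Fintype.equivFin S).injective (congrArg Prod.snd huv)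
  have hΦ := isICPTP_relabelOp c hf
  have hqfi := two_mul_norm_sq_mul_norm_sq_le_qfi (hΦ.isState (isState_ketbra hψ))
    (hH.kronecker (Matrix.isDiag_one (n := Fin (Fintype.card S)))) (f s) (f t)
  rw [relabelOp_apply_apply hf] at hqfi
  simp only [Matrix.kronecker_apply, Matrix.one_apply_eq, mul_one, f, if_neg hst, if_true, hxy,
    Complex.norm_real, Real.norm_eq_abs, sq_abs] at hqfi
  calc ENNReal.ofReal (2 * spectralSpread (signalHamiltonian h N) ^ 2) * ‖ketbra ψ s t‖ₑ ^ 2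
      = ENNReal.ofReal
          (2 * (‖ketbra ψ s t‖ ^ 2 * spectralSpread (signalHamiltonian h N) ^ 2)) := by
        rw [← ofReal_norm, ← ENNReal.ofReal_pow (norm_nonneg _),
          ← ENNReal.ofReal_mul (by positivity)]
        ring_nf
    _ ≤ _ := ENNReal.ofReal_le_ofReal hqfi
    _ ≤ qfiCoherencePure c h N ψ := le_iSup_of_le _ (le_iSup_of_le _ (le_iSup_of_le hΦ le_rfl))

theorem le_qfiCoherence (c : IncoherentOpClass) (h_herm : ∀ i, (h i).IsHermitian)
    (h_diag : ∀ i, (h i).IsDiag) (N : ℕ) (ρ : Matrix S S ℂ) {s t : S} (hst : s ≠ t) :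
    ENNReal.ofReal (2 * spectralSpread (signalHamiltonian h N) ^ 2) * ‖ρ s t‖ₑ ^ 2 ≤
      qfiCoherence c h N ρ := by
  refine le_iInf fun r => le_iInf fun p => le_iInf fun ψ => le_iInf fun hdec => ?_
  set κ := ENNReal.ofReal (2 * spectralSpread (signalHamiltonian h N) ^ 2)
  calc κ * ‖ρ s t‖ₑ ^ 2 ≤ κ * ∑ k, (p k : ℝ≥0∞) * ‖ketbra (ψ k) s t‖ₑ ^ 2 := by
        gcongr
        exact enorm_sq_apply_le_of_isPureDecomposition hdec s t
    _ = ∑ k, (p k : ℝ≥0∞) * (κ * ‖ketbra (ψ k) s t‖ₑ ^ 2) := by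
        simp only [Finset.mul_sum, mul_left_comm]
    _ ≤ ∑ k, (p k : ℝ≥0∞) * qfiCoherencePure c h N (ψ k) := by
        gcongr with k
        exact le_qfiCoherencePure c h_herm h_diag N (hdec.2.1 k) hst

theorem qfiCoherence_le_of_ensemble (c : IncoherentOpClass)
    (h : (i : ℕ) → Matrix (Fin (d i)) (Fin (d i)) ℂ) (N : ℕ) {ι : Type*} [Fintype ι] {p : ι → ℝ}
    {ψ : ι → S → ℂ} (hp : ∀ k, 0 ≤ p k) (hsum : ∑ k, p k = 1) (hψ : ∀ k, ∑ s, ‖ψ k s‖ ^ 2 = 1)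
    (hρ : ρ = ∑ k, (p k : ℂ) • ketbra (ψ k)) {B : ℝ≥0∞}
    (hB : ∀ k, qfiCoherencePure c h N (ψ k) ≤ B) : qfiCoherence c h N ρ ≤ B := by
  let e := (Fintype.equivFin ι).symm
  have hdec : IsPureDecomposition ρ (fun k => (p (e k)).toNNReal) fun k => ψ (e k) := by
    refine ⟨?_, fun k => hψ (e k), ?_⟩
    · rw [e.sum_comp fun k => (p k).toNNReal, ← Real.toNNReal_sum_of_nonneg fun k _ => hp k, hsum,
        Real.toNNReal_one]
    · simp only [Real.coe_toNNReal _ (hp _)]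
      rw [hρ, e.sum_comp fun k => (p k : ℂ) • ketbra (ψ k)]
  calc qfiCoherence c h N ρ
      ≤ ∑ k, ((p (e k)).toNNReal : ℝ≥0∞) * qfiCoherencePure c h N (ψ (e k)) :=
        iInf_le_of_le _ (iInf_le_of_le _ (iInf_le_of_le _ (iInf_le_of_le hdec le_rfl)))
    _ ≤ ∑ k, ((p (e k)).toNNReal : ℝ≥0∞) * B := by
        gcongr with k
        exact hB (e k)
    _ = B := by
        rw [← Finset.sum_mul, ← ENNReal.ofNNReal_finsetSum, hdec.1, ENNReal.coe_one, one_mul]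

theorem qfiCoherence_le (c : IncoherentOpClass) (h_diag : ∀ i, (h i).IsDiag) (N : ℕ)
    (hρ : IsState ρ) :
    qfiCoherence c h N ρ ≤ ENNReal.ofReal (4 * spectralSpread (signalHamiltonian h N) ^ 2) :=
  have hcol := sum_norm_sq_eigenvectorUnitary_col hρ.1.isHermitian
  qfiCoherence_le_of_ensemble c h N hρ.1.eigenvalues_nonneg hρ.sum_eigenvalues hcol
    (eq_sum_smul_ketbra_eigenvectors hρ.1.isHermitian)
    fun i => qfiCoherencePure_le c h_diag N (hcol i)

theorem qfiCoherence_eq_zero (c : IncoherentOpClass) (h_diag : ∀ i, (h i).IsDiag) (N : ℕ)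
    (hρ : IsIncoherent ρ) : qfiCoherence c h N ρ = 0 :=
  nonpos_iff_eq_zero.1 <|
    qfiCoherence_le_of_ensemble c h N hρ.1.re_apply_self_nonneg hρ.1.sum_re_apply_self
      sum_norm_sq_single hρ.eq_sum_smul_ketbra_single
      fun s => (qfiCoherencePure_eq_zero c h_diag N (isIncoherent_ketbra_single s)).le

end Coherence

section Asymptotics

theorem tendsto_log_mul_pow_div_log {u : ℕ → ℝ} {α a : ℝ} (k : ℕ) (ha : a ≠ 0)
    (hu₀ : ∀ᶠ N in atTop, u N ≠ 0)
    (hu : Tendsto (fun N : ℕ => Real.log (u N) / Real.log N) atTop (𝓝 α)) :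
    Tendsto (fun N : ℕ => Real.log (a * u N ^ k) / Real.log N) atTop (𝓝 (k * α)) := by
  have hlog : Tendsto (fun N : ℕ => Real.log N) atTop atTop :=
    Real.tendsto_log_atTop.comp tendsto_natCast_atTop_atTop
  have hsum := (hlog.const_div_atTop (Real.log a)).add (hu.const_mul (k : ℝ))
  rw [zero_add] at hsum
  refine hsum.congr' ?_
  filter_upwards [hu₀] with N hN
  rw [Real.log_mul ha (pow_ne_zero k hN), Real.log_pow, add_div, mul_div_assoc]

theorem tendsto_log_sum_div_log_of_bounded {φ : ℕ → ℝ} {m M : ℝ} (hm : 0 < m)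
    (hmφ : ∀ i, m ≤ φ i) (hφM : ∀ i, φ i ≤ M) :
    Tendsto (fun N : ℕ => Real.log (∑ i : Fin N, φ i) / Real.log N) atTop (𝓝 1) := by
  have hM : 0 < M := hm.trans_le ((hmφ 0).trans (hφM 0))
  have hlinear {a : ℝ} (ha : 0 < a) :
      Tendsto (fun N : ℕ => Real.log (a * N) / Real.log N) atTop (𝓝 1) := by
    have hself : Tendsto (fun N : ℕ => Real.log N / Real.log N) atTop (𝓝 1) := by
      refine tendsto_const_nhds.congr' ?_
      filter_upwards [eventually_gt_atTop 1] with N hN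
      exact (div_self (Real.log_pos (by exact_mod_cast hN)).ne').symm
    have hne : ∀ᶠ N : ℕ in atTop, (N : ℝ) ≠ 0 :=
      (eventually_ne_atTop 0).mono fun N hN => Nat.cast_ne_zero.2 hN
    simpa using tendsto_log_mul_pow_div_log 1 ha.ne' hne hself
  have hlow (N : ℕ) : m * N ≤ ∑ i : Fin N, φ i := by
    simpa [mul_comm] using Finset.card_nsmul_le_sum Finset.univ (fun i : Fin N => φ i) m
      fun i _ => hmφ i
  have hup (N : ℕ) : ∑ i : Fin N, φ i ≤ M * N := by
    simpa [mul_comm] using Finset.sum_le_card_nsmul Finset.univ (fun i : Fin N => φ i) M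
      fun i _ => hφM i
  refine tendsto_of_tendsto_of_tendsto_of_le_of_le' (hlinear hm) (hlinear hM) ?_ ?_
  all_goals
    filter_upwards [eventually_gt_atTop 0] with N hN
    have hpos : 0 < m * N := by positivity
  · exact div_le_div_of_nonneg_right (Real.log_le_log hpos (hlow N)) (Real.log_natCast_nonneg N)
  · exact div_le_div_of_nonneg_right (Real.log_le_log (hpos.trans_le (hlow N)) (hup N))
      (Real.log_natCast_nonneg N)

theorem ennreal_log_ofReal_div_log_natCast {x : ℝ} (hx : 0 < x) {N : ℕ} (hN : 0 < N) :
    ENNReal.log (ENNReal.ofReal x) / ENNReal.log (N : ℝ≥0∞) =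
      ((Real.log x / Real.log N : ℝ) : EReal) := by
  rw [← ENNReal.ofReal_natCast, ENNReal.log_ofReal_of_pos hx,
    ENNReal.log_ofReal_of_pos (Nat.cast_pos.2 hN), EReal.coe_div]

theorem tendsto_ennreal_log_div_log_of_le_of_le {f : ℕ → ℝ≥0∞} {u v : ℕ → ℝ} {α : ℝ}
    (hu₀ : ∀ᶠ N in atTop, 0 < u N) (huf : ∀ N, ENNReal.ofReal (u N) ≤ f N)
    (hfv : ∀ N, f N ≤ ENNReal.ofReal (v N))
    (hu : Tendsto (fun N : ℕ => Real.log (u N) / Real.log N) atTop (𝓝 α))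
    (hv : Tendsto (fun N : ℕ => Real.log (v N) / Real.log N) atTop (𝓝 α)) :
    Tendsto (fun N : ℕ => ENNReal.log (f N) / ENNReal.log (N : ℝ≥0∞)) atTop
      (𝓝 (α : EReal)) := by
  have hlog_nonneg {N : ℕ} (hN : 0 < N) : 0 ≤ ENNReal.log (N : ℝ≥0∞) :=
    ENNReal.zero_le_log_iff.2 (Nat.one_le_cast.2 hN)
  refine tendsto_of_tendsto_of_tendsto_of_le_of_le' (EReal.tendsto_coe.2 hu)
    (EReal.tendsto_coe.2 hv) ?_ ?_
  all_goals filter_upwards [eventually_gt_atTop 0, hu₀] with N hN huN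
  · rw [← ennreal_log_ofReal_div_log_natCast huN hN]
    exact EReal.div_le_div_right_of_nonneg (hlog_nonneg hN) (ENNReal.log_le_log (huf N))
  · have hvN : 0 < v N := (ENNReal.ofReal_pos.1 <|
      (ENNReal.ofReal_pos.2 huN).trans_le ((huf N).trans (hfv N)))
    rw [← ennreal_log_ofReal_div_log_natCast hvN hN]
    exact EReal.div_le_div_right_of_nonneg (hlog_nonneg hN) (ENNReal.log_le_log (hfv N))

variable {S : Type*} [Fintype S] [DecidableEq S] {d : ℕ → ℕ} {c : IncoherentOpClass}
  {h : (i : ℕ) → Matrix (Fin (d i)) (Fin (d i)) ℂ} {ρ : Matrix S S ℂ}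

theorem tendsto_log_spectralSpread_signalHamiltonian (h_herm : ∀ i, (h i).IsHermitian)
    (h_diag : ∀ i, (h i).IsDiag) (h_lower : ∃ m : ℝ, 0 < m ∧ ∀ i, m ≤ spectralSpread (h i))
    (h_upper : ∃ M : ℝ, ∀ i, spectralSpread (h i) ≤ M) :
    Tendsto (fun N : ℕ => Real.log (spectralSpread (signalHamiltonian h N)) / Real.log N)
      atTop (𝓝 1) := by
  obtain ⟨m, hm, hmφ⟩ := h_lower
  obtain ⟨M, hφM⟩ := h_upper
  have hd (i : ℕ) : NeZero (d i) :=
    .of_pos (Fin.pos_iff_nonempty.2 (nonempty_of_spectralSpread_pos (hm.trans_le (hmφ i))))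
  refine (tendsto_log_sum_div_log_of_bounded hm hmφ hφM).congr fun N => ?_
  rw [spectralSpread_signalHamiltonian h_herm h_diag]

theorem tendsto_qfiLogRatio_of_isIncoherent (h_diag : ∀ i, (h i).IsDiag) (hρ : IsIncoherent ρ) :
    Tendsto (qfiLogRatio c h ρ) atTop (𝓝 ⊥) := by
  refine tendsto_const_nhds.congr' ?_
  filter_upwards [eventually_gt_atTop 1] with N hN
  rw [qfiLogRatio, qfiCoherence_eq_zero c h_diag N hρ, ENNReal.log_zero,
    EReal.bot_div_of_pos_ne_top]
  · exact ENNReal.zero_lt_log_iff.2 (Nat.one_lt_cast.2 hN)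
  · exact ENNReal.log_eq_top_iff.not.2 (ENNReal.natCast_ne_top N)

theorem tendsto_qfiLogRatio_of_isCoherent (h_herm : ∀ i, (h i).IsHermitian)
    (h_diag : ∀ i, (h i).IsDiag) {α : ℝ} (hα : 0 < α)
    (h_spread : Tendsto
      (fun N : ℕ => Real.log (spectralSpread (signalHamiltonian h N)) / Real.log N) atTop (𝓝 α))
    (hρ : IsCoherent ρ) : Tendsto (qfiLogRatio c h ρ) atTop (𝓝 ((2 * α : ℝ) : EReal)) := by
  obtain ⟨s, t, hst, hne⟩ := hρ.exists_ne_apply_ne_zero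
  have hspread₀ : ∀ᶠ N in atTop, spectralSpread (signalHamiltonian h N) ≠ 0 := by
    filter_upwards [h_spread.eventually_ne hα.ne'] with N hN hzero
    simp [hzero] at hN
  refine tendsto_ennreal_log_div_log_of_le_of_le ?_ (fun N => ?_)
    (fun N => qfiCoherence_le c h_diag N hρ.1)
    (tendsto_log_mul_pow_div_log 2 (a := 2 * ‖ρ s t‖ ^ 2) (by positivity) hspread₀ h_spread)
    (tendsto_log_mul_pow_div_log 2 four_ne_zero hspread₀ h_spread)
  · filter_upwards [hspread₀] with N hN
    positivity
  · refine le_of_eq_of_le ?_ (le_qfiCoherence c h_herm h_diag N ρ hst)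
    rw [← ofReal_norm, ← ENNReal.ofReal_pow (norm_nonneg _),
      ← ENNReal.ofReal_mul (by positivity), mul_right_comm]

theorem asymptoticQFICoherence_of_isIncoherent (h_diag : ∀ i, (h i).IsDiag)
    (hρ : IsIncoherent ρ) : asymptoticQFICoherence c h ρ = 0 := by
  rw [asymptoticQFICoherence, (tendsto_qfiLogRatio_of_isIncoherent h_diag hρ).limUnder_eq,
    EReal.bot_sub, max_eq_right bot_le]

theorem asymptoticQFICoherence_of_isCoherent (h_herm : ∀ i, (h i).IsHermitian)
    (h_diag : ∀ i, (h i).IsDiag) {α : ℝ} (hα : 0 < α)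
    (h_spread : Tendsto
      (fun N : ℕ => Real.log (spectralSpread (signalHamiltonian h N)) / Real.log N) atTop (𝓝 α))
    (hρ : IsCoherent ρ) :
    asymptoticQFICoherence c h ρ = ((max (2 * α - 1) 0 : ℝ) : EReal) := by
  rw [asymptoticQFICoherence,
    (tendsto_qfiLogRatio_of_isCoherent h_herm h_diag hα h_spread hρ).limUnder_eq,
    EReal.coe_strictMono.monotone.map_max, EReal.coe_sub, EReal.coe_one, EReal.coe_zero]

end Asymptotics

theorem mainTheorem8_general {S : Type*} [Fintype S] [DecidableEq S] (c : IncoherentOpClass)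
    (d : ℕ → ℕ) (h : (i : ℕ) → Matrix (Fin (d i)) (Fin (d i)) ℂ)
    (h_herm : ∀ i, (h i).IsHermitian) (h_diag : ∀ i, (h i).IsDiag)
    (h_spread : Tendsto
      (fun N : ℕ => Real.log (spectralSpread (signalHamiltonian h N)) / Real.log N) atTop (𝓝 1))
    (ρ : Matrix S S ℂ) (hρ : IsState ρ) :
    (∃ L : EReal, Tendsto (qfiLogRatio c h ρ) atTop (𝓝 L)) ∧
      (asymptoticQFICoherence c h ρ = 1 ↔ IsCoherent ρ) ∧
      (asymptoticQFICoherence c h ρ = 0 ↔ IsIncoherent ρ) := by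
  by_cases hinc : IsIncoherent ρ
  · have hzero := asymptoticQFICoherence_of_isIncoherent (c := c) h_diag hinc
    exact ⟨⟨_, tendsto_qfiLogRatio_of_isIncoherent h_diag hinc⟩,
      iff_of_false (hzero.trans_ne zero_ne_one) fun hcoh => hcoh.2 hinc, iff_of_true hzero hinc⟩
  · have hcoh : IsCoherent ρ := ⟨hρ, hinc⟩
    have hone : asymptoticQFICoherence c h ρ = 1 := by
      rw [asymptoticQFICoherence_of_isCoherent h_herm h_diag one_pos h_spread hcoh]
      norm_num
    exact ⟨⟨_, tendsto_qfiLogRatio_of_isCoherent h_herm h_diag one_pos h_spread hcoh⟩,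
      iff_of_true hone hcoh, iff_of_false (hone.trans_ne one_ne_zero) hinc⟩

theorem mainTheorem8 {S : Type*} [Fintype S] [DecidableEq S] (c : IncoherentOpClass)
    (d : ℕ → ℕ) (h : (i : ℕ) → Matrix (Fin (d i)) (Fin (d i)) ℂ)
    (h_herm : ∀ i, (h i).IsHermitian) (h_diag : ∀ i, (h i).IsDiag)
    (h_lower : ∃ m : ℝ, 0 < m ∧ ∀ i, m ≤ spectralSpread (h i))
    (h_upper : ∃ M : ℝ, ∀ i, spectralSpread (h i) ≤ M)
    (ρ : Matrix S S ℂ) (hρ : IsState ρ) :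
    (∃ L : EReal, Tendsto (qfiLogRatio c h ρ) atTop (𝓝 L)) ∧
      (asymptoticQFICoherence c h ρ = 1 ↔ IsCoherent ρ) ∧
      (asymptoticQFICoherence c h ρ = 0 ↔ IsIncoherent ρ) :=
  mainTheorem8_general c d h h_herm h_diag
    (tendsto_log_spectralSpread_signalHamiltonian h_herm h_diag h_lower h_upper) ρ hρ
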